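/- Let $G$ be a finite simple connected graph of order $n \ge 2$ with maximum degree at most $\Delta$, where $\Delta \ge 2$ is an integer, and suppose that $n^{\Delta} \ge 7$ (that is, $(n,\Delta) \ne (2,2)$). Let $\boxtimes G^{\Delta}$ be the $\Delta$-th strong power of $G$: its vertices are the $\Delta$-tuples of vertices of $G$, and two distinct tuples $x, y$ are adjacent if and only if for every $i$ either $x_i = y_i$ or $x_i y_i \in E(G)$. Then $D'(\boxtimes G^{\Delta}) = 2$, where the distinguishing index $D'(H)$ of a graph $H$ is the least integer $d$ such that $H$ has a (not necessarily proper) labeling of its edges with $d$ labels that is preserved by no automorphism of $H$ other than the identity. -/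

import Mathlib

namespace SimpleGraph

/-- The strong product of a family of graphs: two distinct tuples are adjacent when in every
coordinate their entries are equal or adjacent. -/
def strongProduct {ι : Type*} {V : ι → Type*} (G : ∀ i, SimpleGraph (V i)) :
    SimpleGraph (∀ i, V i) where
  Adj x y := x ≠ y ∧ ∀ i, x i = y i ∨ (G i).Adj (x i) (y i)
  symm := ⟨fun _ _ h => ⟨h.1.symm, fun i => (h.2 i).imp Eq.symm (fun h' => h'.symm)⟩⟩
  loopless := ⟨fun _ h => h.1 rfl⟩

/-- The `k`-th strong power of `G`, the strong product of `k` copies of `G`. -/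
def strongPower {V : Type*} (G : SimpleGraph V) (k : ℕ) : SimpleGraph (Fin k → V) :=
  strongProduct fun _ : Fin k => G

/-- An edge labeling is distinguishing if the identity is the only automorphism of the graph
that preserves the labels of all edges. The labeling need not be proper. -/
def IsDistinguishingEdgeLabeling {V K : Type*} (G : SimpleGraph V) (c : G.edgeSet → K) : Prop :=
  ∀ σ : G ≃g G, (∀ e : G.edgeSet, c (σ.mapEdgeSet e) = c e) → ∀ v, σ v = v

/-- The distinguishing index of `G`: the least number `d` such that `G` has a distinguishing edge
labeling with `d` labels. It is `⊤` if no such `d` exists. -/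
noncomputable def distinguishingIndex {V : Type*} (G : SimpleGraph V) : ℕ∞ :=
  ⨅ (d : ℕ) (_ : ∃ c : G.edgeSet → Fin d, G.IsDistinguishingEdgeLabeling c), (d : ℕ∞)

end SimpleGraph

/-! One label never suffices, because swapping two coordinates is a nontrivial automorphism of the
power. Two labels suffice as soon as the power has a rigid spanning subgraph `H`: give the edges of
`H` one label and all other edges the other. An automorphism that preserves the labels is then an
automorphism of `H`, hence the identity. If `G` has two vertices, the power is a complete graph on
at least seven vertices, and a path with one chord (`pathWithTriangle`) serves as `H`. If `G` has at
least three vertices, a connected rigid `H` is built by induction on the exponent, starting from the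
square (`exists_rigid_le_strongPower`). In the inductive step, copies of a connected rigid `K` are
joined along a spanning tree of `G`, with one edge per tree edge, each in a row of its own.
Cardinalities separate these bridges from the edges inside copies, so automorphisms permute the
copies. Rigidity of `K` then preserves rows, and the rows identify the bridges (`joinCopies_rigid`).
For the square, take a spanning tree rooted at a vertex `r` of maximum degree and containing all
edges at `r`. The Cartesian square of the tree, with one edge removed and some diagonal edges added,
is rigid (`squareGraph_rigid`). The vertex `(r, r)` is the only one of largest degree. Its
neighbourhood contains a zigzag path with a recognizable end, so it is fixed pointwise. Every
further vertex is then pinned down as a common neighbour of two fixed vertices. -/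

namespace SimpleGraph

/-! ### Rigid spanning subgraphs and bounds on the distinguishing index -/

/-- A graph is rigid if the identity is its only automorphism. -/
def Rigid {V : Type*} (H : SimpleGraph V) : Prop :=
  ∀ σ : Equiv.Perm V, (∀ a b, H.Adj (σ a) (σ b) ↔ H.Adj a b) → ∀ v, σ v = v

theorem Rigid.comap {V W : Type*} {H : SimpleGraph W} (hH : H.Rigid) (e : V ≃ W) :
    (H.comap e).Rigid := by
  intro σ hσ v
  have := hH ((e.symm.trans σ).trans e) (fun a b => by
    have := hσ (e.symm a) (e.symm b)
    simpa [comap_adj] using this) (e v)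
  simpa using this

theorem Connected.comap_equiv {V W : Type*} {H : SimpleGraph W} (hH : H.Connected) (e : V ≃ W) :
    (H.comap e).Connected :=
  (Iso.comap e H).connected_iff.2 hH

/-- Labeling the edges of a graph by membership in a rigid spanning subgraph distinguishes. -/
theorem exists_isDistinguishingEdgeLabeling_of_rigid {V : Type*} {X H : SimpleGraph V}
    (hle : H ≤ X) (hH : H.Rigid) :
    ∃ c : X.edgeSet → Fin 2, X.IsDistinguishingEdgeLabeling c := by
  classical
  refine ⟨fun e => if (e : Sym2 V) ∈ H.edgeSet then 1 else 0, fun σ hσ v => ?_⟩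
  refine hH σ.toEquiv (fun a b => ?_) v
  by_cases hab : X.Adj a b
  · have h := hσ ⟨s(a, b), hab⟩
    have h' : ((σ.mapEdgeSet ⟨s(a, b), hab⟩ : X.edgeSet) : Sym2 V) = s(σ a, σ b) := rfl
    simp only [h', mem_edgeSet] at h
    by_cases h1 : H.Adj a b <;> by_cases h2 : H.Adj (σ a) (σ b) <;> simp_all
  · have h2 : ¬ X.Adj (σ a) (σ b) := fun h => hab (σ.map_adj_iff.1 h)
    exact iff_of_false (fun h => h2 (hle h)) (fun h => hab (hle h))

theorem distinguishingIndex_le_two {V : Type*} {X H : SimpleGraph V}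
    (hle : H ≤ X) (hH : H.Rigid) : X.distinguishingIndex ≤ 2 :=
  iInf₂_le_of_le 2 (exists_isDistinguishingEdgeLabeling_of_rigid hle hH) le_rfl

theorem two_le_distinguishingIndex {V : Type*} {X : SimpleGraph V} (σ : X ≃g X)
    {v : V} (hv : σ v ≠ v) : 2 ≤ X.distinguishingIndex := by
  refine le_iInf₂ fun d ⟨c, hc⟩ => ?_
  by_contra hd
  have hd : d < 2 := by simpa using hd
  have : Subsingleton (Fin d) := Fin.subsingleton_iff_le_one.2 (by omega)
  exact hv (hc σ (fun _ => Subsingleton.elim _ _) v)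

/-- The automorphism of a strong power that permutes the coordinates. -/
def strongPowerPermIso {V : Type*} (G : SimpleGraph V) {k : ℕ} (π : Equiv.Perm (Fin k)) :
    G.strongPower k ≃g G.strongPower k where
  toEquiv := Equiv.arrowCongr π (Equiv.refl V)
  map_rel_iff' := by
    intro x y
    simp only [strongPower, strongProduct, ne_eq, EmbeddingLike.apply_eq_iff_eq,
      Equiv.arrowCongr_apply, Function.comp_apply, Equiv.refl_apply]
    exact and_congr_right fun _ =>
      (π.symm.surjective.forall (p := fun i => x i = y i ∨ G.Adj (x i) (y i))).symm

theorem two_le_distinguishingIndex_strongPower {V : Type*} [Nontrivial V] (G : SimpleGraph V)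
    {k : ℕ} (hk : 2 ≤ k) : 2 ≤ (G.strongPower k).distinguishingIndex := by
  obtain ⟨a, b, hab⟩ := exists_pair_ne V
  have : NeZero k := ⟨by omega⟩
  let i : Fin k := ⟨0, by omega⟩
  let j : Fin k := ⟨1, by omega⟩
  have hij : j ≠ i := by simp [i, j]
  -- The tuple `(a, b, b, …)` is moved by the swap of the first two coordinates.
  refine two_le_distinguishingIndex (G.strongPowerPermIso (Equiv.swap i j))
    (v := Function.update (fun _ => b) i a) fun h => hab ?_
  have := congrFun h i
  simp [strongPowerPermIso, Equiv.arrowCongr_apply, hij] at this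
  exact this.symm

/-! ### A rigid graph on any number of vertices from six on -/

/-- The path `0, 1, …, N - 1` with the additional edge `{1, 3}`. -/
def pathWithTriangle (N : ℕ) : SimpleGraph (Fin N) where
  Adj i j := (i : ℕ) + 1 = j ∨ (j : ℕ) + 1 = i ∨ (i : ℕ) = 1 ∧ (j : ℕ) = 3 ∨
    (i : ℕ) = 3 ∧ (j : ℕ) = 1
  symm := ⟨fun i j h => by omega⟩
  loopless := ⟨fun i h => by omega⟩

/-- The ends `0` and `N - 1` are the only leaves, and their neighbours have degrees 3 and 2, so `0`
and `1` are fixed. Here `6 ≤ N` matters: for `N = 5` the graph has a reflection. Of the other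
neighbours of `1`, only `3` is adjacent to `4`; from there on the path is followed vertex by vertex.
-/
theorem pathWithTriangle_rigid {N : ℕ} (hN : 6 ≤ N) : (pathWithTriangle N).Rigid := by
  intro σ hσ
  have inj : ∀ i j : Fin N, (σ i : ℕ) = σ j → i = j := fun i j h => σ.injective (Fin.ext h)
  have surj : ∀ k : ℕ, k < N → ∃ i : Fin N, (σ i : ℕ) = k := fun k hk => by
    obtain ⟨i, hi⟩ := σ.surjective ⟨k, hk⟩
    exact ⟨i, by rw [hi]⟩
  simp only [pathWithTriangle] at hσ
  have step : ∀ i : Fin N, ∀ k : ℕ, k < N → ((σ i : ℕ) + 1 = k ∨ k + 1 = σ i ∨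
      (σ i : ℕ) = 1 ∧ k = 3 ∨ (σ i : ℕ) = 3 ∧ k = 1) →
      ∃ j : Fin N, (σ j : ℕ) = k ∧ ((i : ℕ) + 1 = j ∨ (j : ℕ) + 1 = i ∨
        (i : ℕ) = 1 ∧ (j : ℕ) = 3 ∨ (i : ℕ) = 3 ∧ (j : ℕ) = 1) := fun i k hk h => by
    obtain ⟨j, hj⟩ := surj k hk
    exact ⟨j, hj, (hσ i j).1 (by rw [hj]; exact h)⟩
  obtain ⟨u0, e0⟩ : ∃ u : Fin N, (u : ℕ) = 0 := ⟨⟨0, by omega⟩, rfl⟩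
  obtain ⟨u1, e1⟩ : ∃ u : Fin N, (u : ℕ) = 1 := ⟨⟨1, by omega⟩, rfl⟩
  obtain ⟨u2, e2⟩ : ∃ u : Fin N, (u : ℕ) = 2 := ⟨⟨2, by omega⟩, rfl⟩
  obtain ⟨u3, e3⟩ : ∃ u : Fin N, (u : ℕ) = 3 := ⟨⟨3, by omega⟩, rfl⟩
  have n02 : (σ u0 : ℕ) ≠ σ u2 := fun h => by have := inj _ _ h; omega
  have n03 : (σ u0 : ℕ) ≠ σ u3 := fun h => by have := inj _ _ h; omega
  have n23 : (σ u2 : ℕ) ≠ σ u3 := fun h => by have := inj _ _ h; omega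
  have a01 := (hσ u0 u1).2 (by omega)
  have a12 := (hσ u1 u2).2 (by omega)
  have a13 := (hσ u1 u3).2 (by omega)
  have s0 : ∀ k < N, ((σ u0 : ℕ) + 1 = k ∨ k + 1 = σ u0) → k = σ u1 := fun k hk h => by
    obtain ⟨j, hj, h'⟩ := step u0 k hk (by omega)
    have : j = u1 := Fin.ext (by omega)
    rw [← hj, this]
  have l0 := (σ u0).isLt
  have l1 := (σ u1).isLt
  -- Otherwise `0` goes to `N - 1` and `1` to `N - 2 ≥ 4`, which has no room for three distinct
  -- neighbours.
  have h0 : (σ u0 : ℕ) = 0 := by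
    by_contra hne
    have b1 := s0 (σ u0 - 1) (by omega) (by omega)
    have b2 : ¬ (σ u0 : ℕ) + 1 < N := fun h => by
      have := s0 (σ u0 + 1) h (by omega)
      omega
    have l2 := (σ u2).isLt
    have l3 := (σ u3).isLt
    omega
  have h1 : (σ u1 : ℕ) = 1 := by omega
  -- Otherwise `2` and `3` are interchanged, and `2` would need a neighbour that maps to `4`.
  have h3 : (σ u3 : ℕ) = 3 := by
    by_contra hne
    obtain ⟨j, hj, h'⟩ := step u2 4 (by omega) (by omega)
    have : j = u1 ∨ j = u3 := by
      rcases (by omega : (j : ℕ) = u1 ∨ (j : ℕ) = u3) with h | h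
      · exact Or.inl (Fin.ext h)
      · exact Or.inr (Fin.ext h)
    rcases this with rfl | rfl <;> omega
  have key : ∀ k : ℕ, ∀ i : Fin N, (i : ℕ) ≤ k → (σ i : ℕ) = i := by
    intro k
    induction k with
    | zero => intro i hi; rw [Fin.ext (by omega : (i : ℕ) = u0)]; omega
    | succ k ih =>
      intro i hi
      rcases Nat.lt_or_ge (i : ℕ) (k + 1) with h | h
      · exact ih i (by omega)
      rcases (by omega : k = 0 ∨ k = 1 ∨ k = 2 ∨ 3 ≤ k) with hk | hk | hk | hk
      · rw [Fin.ext (by omega : (i : ℕ) = u1)]; omega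
      · rw [Fin.ext (by omega : (i : ℕ) = u2)]; omega
      · rw [Fin.ext (by omega : (i : ℕ) = u3)]; omega
      · have hki : k < N := by omega
        have f1 := ih ⟨k, hki⟩ le_rfl
        have f2 := ih ⟨k - 1, by omega⟩ (by simp)
        have a := (hσ ⟨k, hki⟩ i).2 (by simp only; omega)
        have b : (σ i : ℕ) ≠ σ ⟨k - 1, by omega⟩ := fun h' => by
          have := congrArg Fin.val (inj _ _ h')
          simp only at this
          omega
        -- Needed for `k = 3`, where the chord makes `1` a further neighbour of `k`.
        have c : (σ i : ℕ) ≠ σ u1 := fun h' => by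
          have := inj _ _ h'
          omega
        simp only at f1 f2
        omega
  exact fun v => Fin.ext (key v v le_rfl)

theorem exists_rigid {V : Type*} [Fintype V] (hV : 6 ≤ Fintype.card V) :
    ∃ H : SimpleGraph V, H.Rigid :=
  ⟨_, (pathWithTriangle_rigid hV).comap (Fintype.equivFin V)⟩

/-! ### Rooted spanning trees -/

/-- A spanning tree of `G` rooted at `r` and containing all edges at `r`, given by its parent map. -/
structure ParentMap {V : Type*} (G : SimpleGraph V) (r : V) where
  parent : V → V
  depth : V → ℕ
  adj_parent : ∀ x, x ≠ r → G.Adj x (parent x)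
  depth_parent : ∀ x, x ≠ r → depth (parent x) + 1 = depth x
  parent_eq_of_adj : ∀ x, G.Adj r x → parent x = r

/-- Send each vertex to the next one on a geodesic to `r`. Neighbours of `r` have distance 1, so
their parent has distance 0. -/
theorem Connected.nonempty_parentMap {V : Type*} {G : SimpleGraph V} (hG : G.Connected) (r : V) :
    Nonempty (G.ParentMap r) := by
  have key : ∀ x, ∃ y, x ≠ r → G.Adj x y ∧ G.dist r y + 1 = G.dist r x := by
    intro x
    by_cases hx : x = r
    · exact ⟨r, fun h => absurd hx h⟩
    obtain ⟨w, hw⟩ := hG.exists_walk_length_eq_dist x r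
    cases w with
    | nil => exact absurd rfl hx
    | cons h q =>
      rename_i y
      refine ⟨y, fun _ => ⟨h, ?_⟩⟩
      have h1 := G.dist_le q
      have h2 := hG.dist_triangle (u := x) (v := y) (w := r)
      rw [dist_eq_one_iff_adj.2 h] at h2
      rw [Walk.length_cons] at hw
      rw [dist_comm (u := r), dist_comm (u := r)]
      omega
  choose p hp using key
  refine ⟨⟨p, G.dist r, fun x hx => (hp x hx).1, fun x hx => (hp x hx).2, fun x hx => ?_⟩⟩
  have h := (hp x hx.ne').2
  rw [dist_eq_one_iff_adj.2 hx] at h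
  exact (hG.dist_eq_zero_iff.1 (by omega)).symm

namespace ParentMap

variable {V : Type*} {G : SimpleGraph V} {r : V}

theorem induction (P : G.ParentMap r) {Q : V → Prop} (root : Q r)
    (step : ∀ x, x ≠ r → Q (P.parent x) → Q x) (x : V) : Q x := by
  induction h : P.depth x using Nat.strong_induction_on generalizing x with
  | _ n ih =>
    by_cases hx : x = r
    · exact hx ▸ root
    · have := P.depth_parent x hx
      exact step x hx (ih _ (by omega) _ rfl)

theorem parent_ne (P : G.ParentMap r) {x : V} (hx : x ≠ r) : P.parent x ≠ x :=
  (P.adj_parent x hx).ne'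

/-! ### Joining copies of a rigid graph along a tree -/

/-- Copies of `K` indexed by the vertices of a rooted tree; the copies at `x` and at the parent of
`x` are joined by a single edge, in the row `f x`. -/
def joinCopies {Y : Type*} (P : G.ParentMap r) (K : SimpleGraph Y) (f : V → Y) :
    SimpleGraph (V × Y) where
  Adj a b := (a.1 = b.1 ∧ K.Adj a.2 b.2) ∨
    (a.1 ≠ r ∧ b = (P.parent a.1, f a.1) ∧ a.2 = f a.1) ∨
    (b.1 ≠ r ∧ a = (P.parent b.1, f b.1) ∧ b.2 = f b.1)
  symm := ⟨fun a b h => by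
    rcases h with h | h | h
    · exact Or.inl ⟨h.1.symm, h.2.symm⟩
    · exact Or.inr (Or.inr h)
    · exact Or.inr (Or.inl h)⟩
  loopless := ⟨fun a h => by
    rcases h with h | h | h
    · exact h.2.ne rfl
    · exact P.parent_ne h.1 (congrArg Prod.fst h.2.1).symm
    · exact P.parent_ne h.1 (congrArg Prod.fst h.2.1).symm⟩

end ParentMap

theorem Connected.eq_of_forall_adj {V α : Type*} {G : SimpleGraph V} (hG : G.Connected) {f : V → α}
    (hf : ∀ a b, G.Adj a b → f a = f b) (a b : V) : f a = f b := by
  obtain ⟨w⟩ := hG.preconnected a b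
  induction w with
  | nil => rfl
  | cons h _ ih => exact (hf _ _ h).trans ih

/-- The pair `(a, b)` is the only edge leaving some set whose size is a multiple of `m`. -/
def IsCut {V : Type*} (H : SimpleGraph V) (m : ℕ) (a b : V) : Prop :=
  ∃ S : Finset V, a ∈ S ∧ b ∉ S ∧ m ∣ S.card ∧
    ∀ x ∈ S, ∀ y ∉ S, H.Adj x y → x = a ∧ y = b

theorem IsCut.map {V : Type*} {H : SimpleGraph V} {m : ℕ} {a b : V} (h : H.IsCut m a b)
    {σ : Equiv.Perm V} (hσ : ∀ a b, H.Adj (σ a) (σ b) ↔ H.Adj a b) :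
    H.IsCut m (σ a) (σ b) := by
  obtain ⟨S, ha, hb, hm, hS⟩ := h
  refine ⟨S.map σ.toEmbedding, by simpa, by simpa, by simpa, fun x hx y hy hxy => ?_⟩
  obtain ⟨x, rfl⟩ := σ.surjective x
  obtain ⟨y, rfl⟩ := σ.surjective y
  have := hS x (by simpa using hx) y (by simpa using hy) ((hσ x y).1 hxy)
  exact ⟨congrArg σ this.1, congrArg σ this.2⟩

namespace ParentMap

variable {V : Type*} {G : SimpleGraph V} {r : V} {Y : Type*}

theorem joinCopies_connected (P : G.ParentMap r) {K : SimpleGraph Y} (hK : K.Connected)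
    (f : V → Y) : (P.joinCopies K f).Connected := by
  have hrow : ∀ x y y', (P.joinCopies K f).Reachable (x, y) (x, y') := by
    intro x y y'
    obtain ⟨w⟩ := hK.preconnected y y'
    induction w with
    | nil => exact Reachable.refl _
    | cons h _ ih => exact (Adj.reachable (Or.inl ⟨rfl, h⟩)).trans ih
  obtain ⟨y₀⟩ := hK.nonempty
  have hall : ∀ x y, (P.joinCopies K f).Reachable (x, y) (r, y₀) := by
    intro x
    induction x using P.induction with
    | root => exact fun y => hrow r y y₀
    | step x hx ih =>
      intro y
      refine (hrow x y (f x)).trans (Reachable.trans ?_ (ih (f x)))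
      exact Adj.reachable (Or.inr (Or.inl ⟨hx, rfl, rfl⟩))
  have : Nonempty (V × Y) := ⟨(r, y₀)⟩
  exact ⟨fun a b => (hall a.1 a.2).trans (hall b.1 b.2).symm⟩

/-- The copies over the subtree below `x` form the required set: only the bridge at `x` leaves it.
-/
theorem joinCopies_isCut [Fintype V] [Fintype Y] (P : G.ParentMap r) (K : SimpleGraph Y)
    {f : V → Y} {x : V} (hx : x ≠ r) :
    (P.joinCopies K f).IsCut (Fintype.card Y) (x, f x) (P.parent x, f x) := by
  classical
  -- The value `P.parent r` is arbitrary, so iterates might run through the root and come back to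
  -- `x`; the depth condition excludes this.
  let D : Finset V := Finset.univ.filter fun u => ∃ k, P.parent^[k] u = x ∧
    P.depth u = P.depth x + k
  have hD : ∀ u, u ∈ D ↔ ∃ k, P.parent^[k] u = x ∧ P.depth u = P.depth x + k := by simp [D]
  have hd := P.depth_parent x hx
  refine ⟨D ×ˢ Finset.univ, ?_, ?_, ?_, ?_⟩
  · simp only [Finset.mem_product, Finset.mem_univ, and_true, hD]
    exact ⟨0, rfl, rfl⟩
  · simp only [Finset.mem_product, Finset.mem_univ, and_true, hD]
    rintro ⟨k, -, h⟩
    omega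
  · simp [Finset.card_product]
  · rintro ⟨u, y⟩ hu ⟨v, z⟩ hv h
    simp only [Finset.mem_product, Finset.mem_univ, and_true, hD] at hu hv
    obtain ⟨k, hk, hk'⟩ := hu
    rcases h with h | ⟨h1, h2, h3⟩ | ⟨h1, h2, h3⟩
    · obtain ⟨rfl, -⟩ : u = v ∧ _ := h
      exact absurd ⟨k, hk, hk'⟩ hv
    · obtain ⟨rfl, rfl⟩ := Prod.mk.inj h2
      simp only at h1 h3
      cases k with
      | zero =>
        obtain rfl : u = x := hk
        exact ⟨by rw [h3], rfl⟩
      | succ k =>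
        have := P.depth_parent u h1
        exact absurd ⟨k, hk, by simp only; omega⟩ hv
    · obtain ⟨rfl, rfl⟩ := Prod.mk.inj h2
      have := P.depth_parent v h1
      simp only at hk hk' h1
      exact absurd ⟨k + 1, hk, by omega⟩ hv

/-- Suppose the only edge leaving `S` lies in the copy over `x`. Every other copy is connected, so
it lies inside or outside `S` and contributes a multiple of `card Y`. The copy over `x` is split
properly, so the size of `S` is no such multiple. -/
theorem not_isCut_joinCopies [Fintype V] [Fintype Y] (P : G.ParentMap r) {K : SimpleGraph Y}
    (hK : K.Connected) {f : V → Y} (x : V) (y z : Y) :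
    ¬ (P.joinCopies K f).IsCut (Fintype.card Y) (x, y) (x, z) := by
  classical
  rintro ⟨S, hy, hz, hm, hS⟩
  rw [Finset.card_eq_sum_card_fiberwise (f := Prod.fst) (t := Finset.univ) (by simp),
    ← Finset.sum_erase_add _ _ (Finset.mem_univ x)] at hm
  have hfib : ∀ u, S.filter (fun a => a.1 = u) =
      (Finset.univ.filter fun y => (u, y) ∈ S).map ⟨fun y => (u, y), Prod.mk_right_injective u⟩ := by
    intro u
    ext ⟨v, y⟩
    simp only [Finset.mem_filter, Finset.mem_map, Finset.mem_univ, true_and,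
      Function.Embedding.coeFn_mk, Prod.mk.injEq]
    grind
  simp only [hfib, Finset.card_map] at hm
  rw [Nat.dvd_add_right] at hm
  · have h1 : 0 < (Finset.univ.filter fun y => (x, y) ∈ S).card :=
      Finset.card_pos.2 ⟨y, by simpa⟩
    have h2 : (Finset.univ.filter fun y => (x, y) ∈ S).card < Fintype.card Y := by
      refine Finset.card_lt_card (Finset.ssubset_univ_iff.2 fun h => hz ?_)
      simpa using h.ge (Finset.mem_univ z)
    exact absurd (Nat.le_of_dvd h1 hm) (by omega)
  · refine Finset.dvd_sum fun u hu => ?_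
    have hux : u ≠ x := Finset.ne_of_mem_erase hu
    have hc : ∀ a b, K.Adj a b → ((u, a) ∈ S) = ((u, b) ∈ S) := by
      have : ∀ a b, K.Adj a b → (u, a) ∈ S → (u, b) ∈ S := fun a b hab ha => by
        by_contra hb
        exact hux (congrArg Prod.fst (hS _ ha _ hb (Or.inl ⟨rfl, hab⟩)).1)
      exact fun a b hab => propext ⟨this a b hab, this b a hab.symm⟩
    have hc := hK.eq_of_forall_adj hc
    by_cases h : (u, y) ∈ S
    · rw [Finset.filter_true_of_mem fun a _ => (hc y a).mp h]
      rfl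
    · rw [Finset.filter_false_of_mem fun a _ h' => h ((hc y a).mpr h')]
      simp

theorem joinCopies_rigid [Fintype V] [Fintype Y] (P : G.ParentMap r) {K : SimpleGraph Y}
    (hK : K.Connected) (hr : K.Rigid) {f : V → Y} (hf : f.Injective) (hV : 3 ≤ Fintype.card V) :
    (P.joinCopies K f).Rigid := by
  classical
  -- An edge inside a copy cannot become a bridge, since `σ⁻¹` would carry the cut back; so each
  -- copy is mapped into a single copy.
  have fib : ∀ σ : Equiv.Perm (V × Y),
      (∀ a b, (P.joinCopies K f).Adj (σ a) (σ b) ↔ (P.joinCopies K f).Adj a b) →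
      ∀ x y z, (σ (x, y)).1 = (σ (x, z)).1 := by
    intro σ hσ x
    refine hK.eq_of_forall_adj fun y z hyz => ?_
    have hσ' : ∀ a b, (P.joinCopies K f).Adj (σ⁻¹ a) (σ⁻¹ b) ↔ (P.joinCopies K f).Adj a b :=
      fun a b => by rw [← hσ]; simp
    have hadj := (hσ (x, y) (x, z)).2 (Or.inl ⟨rfl, hyz⟩)
    rcases hadj with h | ⟨h1, h2, h3⟩ | ⟨h1, h2, h3⟩
    · exact h.1
    · have := (P.joinCopies_isCut K (f := f) h1).map hσ'
      rw [← h2, ← h3] at this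
      exact absurd (by simpa using this) (P.not_isCut_joinCopies hK (f := f) x y z)
    · have := (P.joinCopies_isCut K (f := f) h1).map hσ'
      rw [← h2, ← h3] at this
      exact absurd (by simpa using this) (P.not_isCut_joinCopies hK (f := f) x z y)
  intro σ hσ
  obtain ⟨y₀⟩ := hK.nonempty
  let τ : V → V := fun x => (σ (x, y₀)).1
  have hτ : ∀ x y, (σ (x, y)).1 = τ x := fun x y => fib σ hσ x y y₀
  have hsnd : ∀ x y, (σ (x, y)).2 = y := by
    intro x
    have hinj : Function.Injective fun y => (σ (x, y)).2 := fun y z h => by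
      have : σ (x, y) = σ (x, z) := Prod.ext (fib σ hσ x y z) h
      simpa using this
    let π : Equiv.Perm Y := Equiv.ofBijective _ (Finite.injective_iff_bijective.1 hinj)
    refine hr π fun y z => ?_
    have h := hσ (x, y) (x, z)
    have e : ∀ a b : V × Y, a.1 = b.1 → ((P.joinCopies K f).Adj a b ↔ K.Adj a.2 b.2) := by
      rintro ⟨u, y⟩ ⟨v, z⟩ (rfl : u = v)
      refine ⟨fun h => ?_, fun h => Or.inl ⟨rfl, h⟩⟩
      rcases h with h | h | h
      · exact h.2
      · exact absurd (congrArg Prod.fst h.2.1).symm (P.parent_ne h.1)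
      · exact absurd (congrArg Prod.fst h.2.1).symm (P.parent_ne h.1)
    rwa [e _ _ (fib σ hσ x y z), e (x, y) (x, z) rfl] at h
  have hσe : ∀ x y, σ (x, y) = (τ x, y) := fun x y => Prod.ext (hτ x y) (hsnd x y)
  have hinj : Function.Injective τ := fun x z h => by
    have : σ (x, y₀) = σ (z, y₀) := by rw [hσe, hσe, h]
    simpa using this
  -- The bridge at `x` goes to a bridge in the same row, which is the same bridge because `f` is
  -- injective; at most its ends are exchanged.
  have hlink : ∀ x, x ≠ r → (τ x = x ∧ τ (P.parent x) = P.parent x) ∨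
      (τ x = P.parent x ∧ τ (P.parent x) = x) := by
    intro x hx
    have h := (hσ (x, f x) (P.parent x, f x)).2 (Or.inr (Or.inl ⟨hx, rfl, rfl⟩))
    rw [hσe, hσe] at h
    rcases h with h | ⟨h1, h2, h3⟩ | ⟨h1, h2, h3⟩
    · exact absurd (hinj h.1).symm (P.parent_ne hx)
    · simp only [Prod.mk.injEq] at h2 h3
      have := hf h3
      left
      exact ⟨this.symm, by rw [h2.1, ← this]⟩
    · simp only [Prod.mk.injEq] at h2 h3
      have := hf h3
      right
      exact ⟨by rw [h2.1, ← this], this.symm⟩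
  have hfix : ∀ x, x ≠ r → τ x = x := by
    intro x hx
    rcases hlink x hx with h | ⟨h1, h2⟩
    · exact h.1
    exfalso
    -- An exchange away from the root would clash with the bridge one level higher.
    have hpr : P.parent x = r := by
      by_contra hne
      have d1 := P.depth_parent x hx
      have d2 := P.depth_parent _ hne
      rcases hlink _ hne with h | h
      · exact P.parent_ne hx (h.1.symm.trans h2)
      · rw [h.1] at h2
        rw [h2] at d2
        omega
    rw [hpr] at h1 h2
    -- Any further tree edge at `r` or `x` would also have to be fixed or reversed, so the tree has
    -- only these two vertices.
    have hQ : ∀ z, z = r ∨ z = x := by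
      intro z
      induction z using P.induction with
      | root => exact Or.inl rfl
      | step z hz ih =>
        right
        rcases hlink z hz with h | h <;> rcases ih with e | e
        · rw [e, h2] at h; exact absurd h.2 hx
        · rw [e, h1] at h; exact absurd h.2.symm hx
        · rw [e, h2] at h; exact h.2.symm
        · rw [e, h1] at h; exact absurd h.2.symm hz
    have hcard : Fintype.card V ≤ ({r, x} : Finset V).card :=
      Finset.card_le_card fun z _ => by simpa using hQ z
    have := hcard.trans Finset.card_le_two
    omega
  rintro ⟨x, y⟩
  rw [hσe]
  by_cases hx : x = r
  · subst hx
    obtain ⟨z, hz⟩ := (Finite.injective_iff_surjective.1 hinj) x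
    by_cases hzx : z = x
    · rw [← hzx, hz, hzx]
    · exact absurd ((hfix z hzx).symm.trans hz) hzx
  · rw [hfix x hx]

/-! ### Sibling labels and the graph on the square -/

/-- Labels below `D` of the vertices of a rooted tree that tell siblings apart; the children of the
root are `child 0, …, child (D - 1)`. -/
structure SiblingLabels (P : G.ParentMap r) (D : ℕ) where
  label : V → ℕ
  child : ℕ → V
  child_ne : ∀ i < D, child i ≠ r
  parent_child : ∀ i < D, P.parent (child i) = r
  label_child : ∀ i < D, label (child i) = i
  label_lt : ∀ x, x ≠ r → label x < D
  child_label : ∀ x, x ≠ r → P.parent x = r → child (label x) = x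
  label_inj : ∀ x z, x ≠ r → z ≠ r → P.parent x = P.parent z → label x = label z → x = z

/-- Number the neighbours of each `u` injectively; maximality of the degree at `r` keeps all numbers
below `G.degree r`. A vertex takes its number among the neighbours of its parent. At `r` the
numbering is a bijection, whose inverse is `child`. -/
theorem nonempty_siblingLabels [Fintype V] [DecidableRel G.Adj] (P : G.ParentMap r)
    (hr : ∀ x, G.degree x ≤ G.degree r) : Nonempty (P.SiblingLabels (G.degree r)) := by
  classical
  have hemb : ∀ u, ∃ e : V → ℕ, (∀ x ∈ G.neighborFinset u, e x < G.degree r) ∧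
      Set.InjOn e (G.neighborFinset u) := by
    intro u
    have e := (G.neighborFinset u).equivFin
    refine ⟨fun x => if h : x ∈ G.neighborFinset u then e ⟨x, h⟩ else 0, fun x hx => ?_,
      fun x hx z hz h => ?_⟩
    · simp only [hx, dif_pos]
      exact (e ⟨x, hx⟩).isLt.trans_le (hr u)
    · rw [Finset.mem_coe] at hx hz
      simp only [hx, hz, dif_pos] at h
      simpa using e.injective (Fin.ext h)
  choose e he hinj using hemb
  have hsurj : ∀ i, ∃ x, i < G.degree r → x ∈ G.neighborFinset r ∧ e r x = i := by
    intro i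
    by_cases hi : i < G.degree r
    · have himg : (G.neighborFinset r).image (e r) = Finset.range (G.degree r) := by
        refine Finset.eq_of_subset_of_card_le (fun j hj => ?_) ?_
        · obtain ⟨x, hx, rfl⟩ := Finset.mem_image.1 hj
          exact Finset.mem_range.2 (he r x hx)
        · rw [Finset.card_image_of_injOn (hinj r), Finset.card_range]
          rfl
      have := himg.ge (Finset.mem_range.2 hi)
      obtain ⟨x, hx, h⟩ := Finset.mem_image.1 this
      exact ⟨x, fun _ => ⟨hx, h⟩⟩
    · exact ⟨r, fun h => absurd h hi⟩
  choose q hq using hsurj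
  have hmem : ∀ x, x ≠ r → x ∈ G.neighborFinset (P.parent x) := fun x hx => by
    simpa using (P.adj_parent x hx).symm
  have hadj : ∀ i < G.degree r, G.Adj r (q i) := fun i hi => by simpa using (hq i hi).1
  have hpar : ∀ i < G.degree r, P.parent (q i) = r :=
    fun i hi => P.parent_eq_of_adj _ (hadj i hi)
  refine ⟨⟨fun x => e (P.parent x) x, q, fun i hi => (hadj i hi).ne', hpar, fun i hi => ?_,
    fun x hx => he _ x (hmem x hx), fun x hx hpx => ?_, fun x z hx hz h h' => ?_⟩⟩
  · rw [hpar i hi, (hq i hi).2]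
  · have hx' := hmem x hx
    rw [hpx] at hx' ⊢
    have := hq _ (he r x hx')
    exact hinj r this.1 hx' this.2
  · refine hinj (P.parent x) (hmem x hx) (h ▸ hmem z hz) ?_
    simpa only [← h] using h'

/-- The oriented edges of `squareGraph`: all edges of the Cartesian square of the tree but one, the
edges from pairs of children of the root to `(r, r)`, and edges in the first row and the first column
that tell siblings apart. -/
def SquareArc {P : G.ParentMap r} {D : ℕ} (L : P.SiblingLabels D) (v w : V × V) : Prop :=
  (v.1 ≠ r ∧ w = (P.parent v.1, v.2) ∧ ¬ (v.1 = L.child 0 ∧ v.2 = L.child 0)) ∨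
  (v.2 ≠ r ∧ w = (v.1, P.parent v.2)) ∨
  (v.1 ≠ r ∧ P.parent v.1 = r ∧ v.2 ≠ r ∧ P.parent v.2 = r ∧ w = (r, r)) ∨
  (v.1 ≠ r ∧ v.2 = r ∧ w = (P.parent v.1, L.child (L.label v.1))) ∨
  (v.1 = r ∧ v.2 ≠ r ∧ w = (L.child (L.label v.2), P.parent v.2)) ∨
  (v.1 ≠ r ∧ P.parent v.1 = r ∧ v.2 = r ∧ L.label v.1 ≠ 0 ∧ w = (r, L.child (L.label v.1 - 1)))

/-- A rigid spanning subgraph of the strong square of `G`. -/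
def squareGraph {P : G.ParentMap r} {D : ℕ} (L : P.SiblingLabels D) : SimpleGraph (V × V) where
  Adj v w := SquareArc L v w ∨ SquareArc L w v
  symm := ⟨fun _ _ h => h.symm⟩
  loopless := ⟨fun v h => by
    have := fun x => P.parent_ne (x := x)
    rcases v with ⟨x, y⟩
    simp only [SquareArc, Prod.mk.injEq, or_self] at h
    grind⟩

variable {P : G.ParentMap r} {D : ℕ} (L : P.SiblingLabels D)

/-- `x` is the root or one of its children. -/
def Near (P : G.ParentMap r) (x : V) : Prop := x = r ∨ P.parent x = r

/-! ### Common neighbours away from the root -/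

/-- Siblings of `x` also give neighbours of `(P.parent x, r)`, but the second vertex encodes the
label of `x` and so excludes them. The remaining alternative covers vertices fixed earlier in the
induction; the next three lemmas play the same role. -/
theorem squareGraph_common_column {x : V} (hx : x ≠ r) (hpx : P.parent x ≠ r) {w : V × V}
    (h1 : (squareGraph L).Adj (P.parent x, r) w)
    (h2 : (squareGraph L).Adj (P.parent x, L.child (L.label x)) w) :
    w = (x, r) ∨ P.depth w.1 ≤ P.depth (P.parent x) ∧ P.Near w.2 := by
  have f1 := P.depth_parent
  have f2 := L.label_lt
  have f3 := L.child_ne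
  have f4 := L.parent_child
  have f5 := L.label_child
  have f6 := L.label_inj
  have f7 := L.child_label
  obtain ⟨a, b⟩ := w
  simp only [squareGraph, SquareArc, Prod.mk.injEq, Near] at *
  grind

theorem squareGraph_common_near {x y : V} (hx : x ≠ r) (hpx : P.parent x ≠ r) (hy : y ≠ r)
    (hpy : P.parent y = r) {w : V × V} (h1 : (squareGraph L).Adj (x, r) w)
    (h2 : (squareGraph L).Adj (P.parent x, y) w) :
    w = (x, y) ∨ P.depth w.1 ≤ P.depth (P.parent x) ∧ P.Near w.2 := by
  have f1 := P.depth_parent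
  have f2 := L.label_lt
  have f3 := L.child_ne
  have f4 := L.parent_child
  have f5 := L.label_child
  have f6 := L.label_inj
  have f7 := L.child_label
  obtain ⟨a, b⟩ := w
  simp only [squareGraph, SquareArc, Prod.mk.injEq, Near] at *
  grind

theorem squareGraph_common_row {y : V} (hy : y ≠ r) (hpy : P.parent y ≠ r) {w : V × V}
    (h1 : (squareGraph L).Adj (r, P.parent y) w)
    (h2 : (squareGraph L).Adj (L.child (L.label y), P.parent y) w) :
    w = (r, y) ∨ P.depth w.2 ≤ P.depth (P.parent y) := by
  have f1 := P.depth_parent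
  have f2 := L.label_lt
  have f3 := L.child_ne
  have f4 := L.parent_child
  have f5 := L.label_child
  have f6 := L.label_inj
  have f7 := L.child_label
  obtain ⟨a, b⟩ := w
  simp only [squareGraph, SquareArc, Prod.mk.injEq] at *
  grind

theorem squareGraph_common_far {x y : V} (hx : x ≠ r) (hy : y ≠ r)
    (hpy : P.parent y ≠ r) {w : V × V} (h1 : (squareGraph L).Adj (P.parent x, y) w)
    (h2 : (squareGraph L).Adj (x, P.parent y) w) :
    w = (x, y) ∨ P.depth w.2 ≤ P.depth (P.parent y) := by
  have f1 := P.depth_parent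
  have f2 := L.label_lt
  have f3 := L.child_ne
  have f4 := L.parent_child
  have f5 := L.label_child
  have f6 := L.label_inj
  have f7 := L.child_label
  obtain ⟨a, b⟩ := w
  simp only [squareGraph, SquareArc, Prod.mk.injEq] at *
  grind

/-! ### The neighbourhood of the root -/

theorem squareGraph_adj_root {w : V × V} (hD : 2 ≤ D) :
    (squareGraph L).Adj (r, r) w ↔ w ≠ (r, r) ∧ P.Near w.1 ∧ P.Near w.2 := by
  have f1 := P.depth_parent
  have f2 := L.label_lt
  have f3 := L.child_ne
  have f4 := L.parent_child
  have f5 := L.label_child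
  have f6 := L.label_inj
  have f7 := L.child_label
  obtain ⟨a, b⟩ := w
  simp only [squareGraph, SquareArc, Prod.mk.injEq, Near, ne_eq] at *
  grind

/-- These edges form the zigzag path `(child 0, r)`, `(r, child 0)`, `(child 1, r)`, `(r, child 1)`,
and so on. -/
theorem squareGraph_adj_row_col {i j : ℕ} (hi : i < D) (hj : j < D) :
    (squareGraph L).Adj (L.child i, r) (r, L.child j) ↔ i = j ∨ i = j + 1 := by
  have f1 := P.depth_parent
  have f2 := L.label_lt
  have f3 := L.child_ne
  have f4 := L.parent_child
  have f5 := L.label_child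
  have f6 := L.label_inj
  have f7 := L.child_label
  simp only [squareGraph, SquareArc, Prod.mk.injEq] at *
  grind

theorem squareGraph_adj_row_diag {i k l : ℕ} (hi : i < D) (hk : k < D) (hl : l < D) :
    (squareGraph L).Adj (L.child i, r) (L.child k, L.child l) ↔ i = k := by
  have f1 := P.depth_parent
  have f2 := L.label_lt
  have f3 := L.child_ne
  have f4 := L.parent_child
  have f5 := L.label_child
  have f6 := L.label_inj
  have f7 := L.child_label
  simp only [squareGraph, SquareArc, Prod.mk.injEq] at *
  grind

/-- The exceptional pair is the removed edge, which marks the start of the zigzag path. -/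
theorem squareGraph_adj_col_diag {j k l : ℕ} (hj : j < D) (hk : k < D) (hl : l < D) :
    (squareGraph L).Adj (r, L.child j) (L.child k, L.child l) ↔ j = l ∧ (k ≠ 0 ∨ l ≠ 0) := by
  have f1 := P.depth_parent
  have f2 := L.label_lt
  have f3 := L.child_ne
  have f4 := L.parent_child
  have f5 := L.label_child
  have f6 := L.label_inj
  have f7 := L.child_label
  simp only [squareGraph, SquareArc, Prod.mk.injEq] at *
  grind

theorem squareGraph_not_adj_row_row {i j : ℕ} (hi : i < D) (hj : j < D) :
    ¬ (squareGraph L).Adj (L.child i, r) (L.child j, r) := by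
  have f1 := P.depth_parent
  have f2 := L.label_lt
  have f3 := L.child_ne
  have f4 := L.parent_child
  have f5 := L.label_child
  have f6 := L.label_inj
  have f7 := L.child_label
  simp only [squareGraph, SquareArc, Prod.mk.injEq] at *
  grind

theorem squareGraph_not_adj_col_col {i j : ℕ} (hi : i < D) (hj : j < D) :
    ¬ (squareGraph L).Adj (r, L.child i) (r, L.child j) := by
  have f1 := P.depth_parent
  have f2 := L.label_lt
  have f3 := L.child_ne
  have f4 := L.parent_child
  have f5 := L.label_child
  have f6 := L.label_inj
  have f7 := L.child_label
  simp only [squareGraph, SquareArc, Prod.mk.injEq] at *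
  grind

theorem squareGraph_not_adj_diag_diag {i j k l : ℕ} (hi : i < D) (hj : j < D) (hk : k < D)
    (hl : l < D) : ¬ (squareGraph L).Adj (L.child i, L.child j) (L.child k, L.child l) := by
  have f1 := P.depth_parent
  have f2 := L.label_lt
  have f3 := L.child_ne
  have f4 := L.parent_child
  have f5 := L.label_child
  have f6 := L.label_inj
  have f7 := L.child_label
  simp only [squareGraph, SquareArc, Prod.mk.injEq] at *
  grind

theorem squareGraph_adj_root_cases {w : V × V} (h : (squareGraph L).Adj (r, r) w) (hD : 2 ≤ D) :
    (∃ i < D, w = (L.child i, r)) ∨ (∃ i < D, w = (r, L.child i)) ∨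
      ∃ i < D, ∃ j < D, w = (L.child i, L.child j) := by
  obtain ⟨h1, h2, h3⟩ := (squareGraph_adj_root L hD).1 h
  have hn : ∀ x, P.Near x → x = r ∨ ∃ i < D, x = L.child i := fun x hx => by
    by_cases hxr : x = r
    · exact Or.inl hxr
    · exact Or.inr ⟨L.label x, L.label_lt x hxr,
        (L.child_label x hxr (hx.resolve_left hxr)).symm⟩
  obtain ⟨a, b⟩ := w
  rcases hn a h2 with rfl | ⟨i, hi, rfl⟩ <;> rcases hn b h3 with rfl | ⟨j, hj, rfl⟩
  · exact absurd rfl h1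
  · exact Or.inr (Or.inl ⟨j, hj, rfl⟩)
  · exact Or.inl ⟨i, hi, rfl⟩
  · exact Or.inr (Or.inr ⟨i, hi, j, hj, rfl⟩)

/-- `child` is injective on labels, so two such `z` would be siblings with equal labels. It bounds
the added diagonal edges entering a given vertex. -/
theorem SiblingLabels.exists_unique_sibling (x y : V) :
    ∃ e : V, ∀ z, z ≠ r → P.parent z = x → L.child (L.label z) = y → z = e := by
  by_cases h : ∃ z, z ≠ r ∧ P.parent z = x ∧ L.child (L.label z) = y
  · obtain ⟨z, hz, hzx, hzy⟩ := h
    refine ⟨z, fun u hu hux huy => L.label_inj u z hu hz (hux.trans hzx.symm) ?_⟩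
    rw [← L.label_child _ (L.label_lt u hu), huy, ← hzy, L.label_child _ (L.label_lt z hz)]
  · exact ⟨r, fun z hz hzx hzy => absurd ⟨z, hz, hzx, hzy⟩ h⟩

/-! ### Degrees: the root is the unique vertex of largest degree -/

/-- Apart from the two copies of `G`, a vertex other than the root has at most three neighbours. -/
theorem squareGraph_exists_neighbours {v : V × V} (hv : v ≠ (r, r)) :
    ∃ e₁ e₂ e₃ : V × V, ∀ w, (squareGraph L).Adj v w →
      (G.Adj v.1 w.1 ∧ w.2 = v.2) ∨ (w.1 = v.1 ∧ G.Adj v.2 w.2) ∨ w = e₁ ∨ w = e₂ ∨ w = e₃ := by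
  have f2 := L.label_lt
  have f3 := L.child_ne
  have f5 := L.label_child
  have f7 := L.child_label
  have f8 := P.adj_parent
  obtain ⟨x, y⟩ := v
  by_cases hx : x = r
  · subst hx
    have hy : y ≠ x := fun h => hv (by rw [h])
    refine ⟨(L.child (L.label y), P.parent y), (y, x), (L.child (L.label y + 1), x), ?_⟩
    rintro ⟨a, b⟩ h
    simp only [squareGraph, SquareArc, Prod.mk.injEq] at h
    simp only [Prod.mk.injEq]
    rcases h with (h | h | h | h | h | h) | (h | h | h | h | h | h)
    · exact absurd rfl h.1
    · exact Or.inr (Or.inl ⟨h.2.1, h.2.2 ▸ f8 y hy⟩)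
    · exact absurd rfl h.1
    · exact absurd rfl h.1
    · exact Or.inr (Or.inr (Or.inl h.2.2))
    · exact absurd rfl h.1
    · exact Or.inl ⟨by rw [h.2.1.1]; exact (f8 a h.1).symm, h.2.1.2.symm⟩
    · exact Or.inr (Or.inl ⟨h.2.1.symm, by rw [h.2.2]; exact (f8 b h.1).symm⟩)
    · exact absurd h.2.2.2.2.2 hy
    · refine Or.inr (Or.inr (Or.inr (Or.inl ⟨?_, h.2.1⟩)))
      rw [h.2.2.2, f7 a h.1 h.2.2.1.symm]
    · exact absurd h.2.2.1.symm (f3 _ (f2 b h.2.1))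
    · refine Or.inr (Or.inr (Or.inr (Or.inr ⟨?_, h.2.2.1⟩)))
      have := f2 a h.1
      rw [h.2.2.2.2.2, f5 _ (by omega), Nat.sub_add_cancel (by omega), f7 a h.1 h.2.1]
  by_cases hy : y = r
  · subst hy
    refine ⟨(P.parent x, L.child (L.label x)), (y, x), (y, L.child (L.label x - 1)), ?_⟩
    rintro ⟨a, b⟩ h
    simp only [squareGraph, SquareArc, Prod.mk.injEq] at h
    simp only [Prod.mk.injEq]
    rcases h with (h | h | h | h | h | h) | (h | h | h | h | h | h)
    · exact Or.inl ⟨h.2.1.1 ▸ f8 x hx, h.2.1.2⟩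
    · exact absurd rfl h.1
    · exact absurd rfl h.2.2.1
    · exact Or.inr (Or.inr (Or.inl h.2.2))
    · exact absurd h.1 hx
    · exact Or.inr (Or.inr (Or.inr (Or.inr h.2.2.2.2)))
    · exact Or.inl ⟨by rw [h.2.1.1]; exact (f8 a h.1).symm, h.2.1.2.symm⟩
    · exact Or.inr (Or.inl ⟨h.2.1.symm, by rw [h.2.2]; exact (f8 b h.1).symm⟩)
    · exact absurd h.2.2.2.2.1 hx
    · exact absurd h.2.2.2.symm (f3 _ (f2 a h.1))
    · refine Or.inr (Or.inr (Or.inr (Or.inl ⟨h.1, ?_⟩)))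
      rw [h.2.2.1, f7 b h.2.1 h.2.2.2.symm]
    · exact absurd h.2.2.2.2.1 hx
  obtain ⟨e₂, h2⟩ := L.exists_unique_sibling x y
  obtain ⟨e₃, h3⟩ := L.exists_unique_sibling y x
  refine ⟨(r, r), (e₂, r), (r, e₃), ?_⟩
  rintro ⟨a, b⟩ h
  simp only [squareGraph, SquareArc, Prod.mk.injEq] at h
  simp only [Prod.mk.injEq]
  rcases h with (h | h | h | h | h | h) | (h | h | h | h | h | h)
  · exact Or.inl ⟨h.2.1.1 ▸ f8 x hx, h.2.1.2⟩
  · exact Or.inr (Or.inl ⟨h.2.1, h.2.2 ▸ f8 y hy⟩)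
  · exact Or.inr (Or.inr (Or.inl h.2.2.2.2))
  · exact absurd h.2.1 hy
  · exact absurd h.1 hx
  · exact absurd h.2.2.1 hy
  · exact Or.inl ⟨by rw [h.2.1.1]; exact (f8 a h.1).symm, h.2.1.2.symm⟩
  · exact Or.inr (Or.inl ⟨h.2.1.symm, by rw [h.2.2]; exact (f8 b h.1).symm⟩)
  · exact absurd h.2.2.2.2.1 hx
  · exact Or.inr (Or.inr (Or.inr (Or.inl ⟨h2 a h.1 h.2.2.1.symm h.2.2.2.symm, h.2.1⟩)))
  · exact Or.inr (Or.inr (Or.inr (Or.inr ⟨h.1, h3 b h.2.1 h.2.2.2.symm h.2.2.1.symm⟩)))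
  · exact absurd h.2.2.2.2.1 hx

theorem squareGraph_degree_root [Fintype V] [DecidableRel (squareGraph L).Adj] (hD : 2 ≤ D) :
    D * D + 2 * D ≤ (squareGraph L).degree (r, r) := by
  classical
  let N : Finset V := insert r ((Finset.range D).image L.child)
  have hN : N.card = D + 1 := by
    rw [Finset.card_insert_of_notMem, Finset.card_image_of_injOn, Finset.card_range]
    · intro i hi j hj h
      rw [← L.label_child i (by simpa using hi), h, L.label_child j (by simpa using hj)]
    · simp only [Finset.mem_image, Finset.mem_range, not_exists, not_and]
      exact L.child_ne
  have hnear : ∀ x ∈ N, P.Near x := by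
    intro x hx
    simp only [N, Finset.mem_insert, Finset.mem_image, Finset.mem_range] at hx
    rcases hx with rfl | ⟨i, hi, rfl⟩
    · exact Or.inl rfl
    · exact Or.inr (L.parent_child i hi)
  have hsub : (N ×ˢ N).erase (r, r) ⊆ (squareGraph L).neighborFinset (r, r) := by
    intro w hw
    simp only [Finset.mem_erase, Finset.mem_product] at hw
    rw [mem_neighborFinset, squareGraph_adj_root L hD]
    exact ⟨hw.1, hnear _ hw.2.1, hnear _ hw.2.2⟩
  have := Finset.card_le_card hsub
  rw [Finset.card_erase_of_mem (by simp [N]), Finset.card_product, hN, card_neighborFinset_eq_degree]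
    at this
  have e : (D + 1) * (D + 1) - 1 = D * D + 2 * D := by
    rw [Nat.sub_eq_iff_eq_add (by nlinarith)]
    ring
  omega

theorem squareGraph_degree_lt [Fintype V] [DecidableRel G.Adj]
    [DecidableRel (squareGraph L).Adj] (hG : ∀ x, G.degree x ≤ D) (hD : 2 ≤ D)
    {v : V × V} (hv : v ≠ (r, r)) : (squareGraph L).degree v < D * D + 2 * D := by
  classical
  obtain ⟨e₁, e₂, e₃, h⟩ := squareGraph_exists_neighbours L hv
  have hsub : (squareGraph L).neighborFinset v ⊆
      (G.neighborFinset v.1).image (fun a => (a, v.2)) ∪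
        ((G.neighborFinset v.2).image (fun b => (v.1, b)) ∪ {e₁, e₂, e₃}) := by
    intro w hw
    rw [mem_neighborFinset] at hw
    simp only [Finset.mem_union, Finset.mem_image, mem_neighborFinset, Finset.mem_insert,
      Finset.mem_singleton]
    rcases h w hw with h | h | h
    · exact Or.inl ⟨w.1, h.1, Prod.ext rfl h.2.symm⟩
    · exact Or.inr (Or.inl ⟨w.2, h.2, Prod.ext h.1.symm rfl⟩)
    · exact Or.inr (Or.inr h)
  have h1 := (Finset.card_le_card hsub).trans ((Finset.card_union_le _ _).trans
    (add_le_add Finset.card_image_le ((Finset.card_union_le _ _).trans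
      (add_le_add Finset.card_image_le Finset.card_le_three))))
  simp only [card_neighborFinset_eq_degree] at h1
  have h2 := hG v.1
  have h3 := hG v.2
  -- The degree is at most `2 * D + 3`, and `3 < D * D`.
  nlinarith

/-! ### Automorphisms fix the neighbourhood of the root -/

theorem apply_eq_of_degree_lt {W : Type*} [Fintype W] {H : SimpleGraph W} [DecidableRel H.Adj]
    {σ : Equiv.Perm W} (hσ : ∀ a b, H.Adj (σ a) (σ b) ↔ H.Adj a b) {c : W}
    (hc : ∀ v, v ≠ c → H.degree v < H.degree c) : σ c = c := by
  by_contra h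
  have := hc _ h
  let e : H ≃g H := ⟨σ, hσ _ _⟩
  have h' : H.degree (e c) = H.degree c := e.degree_eq c
  exact absurd h' this.ne

/-- The image of `v` is again a common neighbour of `a` and `b`; if it were one of the fixed ones,
injectivity would make it `v` anyway. -/
theorem apply_eq_of_adj_of_adj {W : Type*} {H : SimpleGraph W} {σ : Equiv.Perm W}
    (hσ : ∀ a b, H.Adj (σ a) (σ b) ↔ H.Adj a b) {a b v : W} (ha : σ a = a) (hb : σ b = b)
    (hav : H.Adj a v) (hbv : H.Adj b v)
    (h : ∀ w, H.Adj a w → H.Adj b w → w = v ∨ σ w = w) : σ v = v := by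
  have h1 := (hσ a v).2 hav
  have h2 := (hσ b v).2 hbv
  rw [ha] at h1
  rw [hb] at h2
  exact (h _ h1 h2).elim id fun h => σ.injective h

theorem SiblingLabels.child_inj {i j : ℕ} (hi : i < D) (hj : j < D)
    (h : L.child i = L.child j) : i = j := by
  rw [← L.label_child i hi, h, L.label_child j hj]

theorem squareGraph_adj_root_row {i : ℕ} (hi : i < D) (hD : 2 ≤ D) :
    (squareGraph L).Adj (r, r) (L.child i, r) :=
  (squareGraph_adj_root L hD).2 ⟨fun h => L.child_ne i hi (congrArg Prod.fst h),
    Or.inr (L.parent_child i hi), Or.inl rfl⟩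

theorem squareGraph_adj_root_col {i : ℕ} (hi : i < D) (hD : 2 ≤ D) :
    (squareGraph L).Adj (r, r) (r, L.child i) :=
  (squareGraph_adj_root L hD).2 ⟨fun h => L.child_ne i hi (congrArg Prod.snd h),
    Or.inl rfl, Or.inr (L.parent_child i hi)⟩

theorem squareGraph_adj_root_diag {i j : ℕ} (hi : i < D) (hj : j < D) (hD : 2 ≤ D) :
    (squareGraph L).Adj (r, r) (L.child i, L.child j) :=
  (squareGraph_adj_root L hD).2 ⟨fun h => L.child_ne i hi (congrArg Prod.fst h),
    Or.inr (L.parent_child i hi), Or.inr (L.parent_child j hj)⟩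

/-- `w` has at least three common neighbours with `c`. -/
def HasThreeCommon {W : Type*} (H : SimpleGraph W) (c w : W) : Prop :=
  ∃ z₁ z₂ z₃, z₁ ≠ z₂ ∧ z₁ ≠ z₃ ∧ z₂ ≠ z₃ ∧ (H.Adj c z₁ ∧ H.Adj w z₁) ∧
    (H.Adj c z₂ ∧ H.Adj w z₂) ∧ H.Adj c z₃ ∧ H.Adj w z₃

theorem HasThreeCommon.map {W : Type*} {H : SimpleGraph W} {c w : W} (h : HasThreeCommon H c w)
    {σ : Equiv.Perm W} (hσ : ∀ a b, H.Adj (σ a) (σ b) ↔ H.Adj a b) (hc : σ c = c) :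
    HasThreeCommon H c (σ w) := by
  have hc' : ∀ z, H.Adj c (σ z) ↔ H.Adj c z := fun z => by rw [← hσ c z, hc]
  obtain ⟨z₁, z₂, z₃, h₁₂, h₁₃, h₂₃, h₁, h₂, h₃⟩ := h
  refine ⟨σ z₁, σ z₂, σ z₃, ?_⟩
  simpa only [hσ, hc', ne_eq, EmbeddingLike.apply_eq_iff_eq] using
    ⟨h₁₂, h₁₃, h₂₃, h₁, h₂, h₃⟩

theorem hasThreeCommon_row {i : ℕ} (hi : i < D) (hD : 2 ≤ D) :
    HasThreeCommon (squareGraph L) (r, r) (L.child i, r) := by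
  refine ⟨(L.child i, L.child 0), (L.child i, L.child 1), (r, L.child i), ?_, ?_, ?_,
    ⟨squareGraph_adj_root_diag L hi (by omega) hD,
      (squareGraph_adj_row_diag L hi hi (by omega)).2 rfl⟩,
    ⟨squareGraph_adj_root_diag L hi (by omega) hD,
      (squareGraph_adj_row_diag L hi hi (by omega)).2 rfl⟩,
    squareGraph_adj_root_col L hi hD, (squareGraph_adj_row_col L hi hi).2 (Or.inl rfl)⟩
  · intro h
    have := L.child_inj (by omega) (by omega) (congrArg Prod.snd h)
    omega
  · exact fun h => L.child_ne i hi (congrArg Prod.fst h)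
  · exact fun h => L.child_ne i hi (congrArg Prod.fst h)

theorem hasThreeCommon_col {j : ℕ} (hj : j < D) (hD : 2 ≤ D) :
    HasThreeCommon (squareGraph L) (r, r) (r, L.child j) := by
  have h1 : (squareGraph L).Adj (r, L.child j) (L.child 1, L.child j) :=
    (squareGraph_adj_col_diag L hj (by omega) hj).2 ⟨rfl, Or.inl (by omega)⟩
  have h2 : (squareGraph L).Adj (r, L.child j) (L.child j, r) :=
    ((squareGraph_adj_row_col L hj hj).2 (Or.inl rfl)).symm
  have n1 : ∀ i, (L.child i, L.child j) ≠ (L.child j, r) := fun i h =>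
    L.child_ne j hj (congrArg Prod.snd h)
  by_cases h0 : j = 0
  · subst h0
    refine ⟨(L.child 1, L.child 0), (L.child 0, r), (L.child 1, r), n1 1, ?_, ?_,
      ⟨squareGraph_adj_root_diag L (by omega) hj hD, h1⟩,
      ⟨squareGraph_adj_root_row L hj hD, h2⟩,
      squareGraph_adj_root_row L (by omega) hD,
      ((squareGraph_adj_row_col L (by omega) hj).2 (Or.inr rfl)).symm⟩
    · exact fun h => L.child_ne 0 hj (congrArg Prod.snd h)
    · intro h
      have := L.child_inj (by omega) (by omega) (congrArg Prod.fst h)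
      omega
  · refine ⟨(L.child 1, L.child j), (L.child j, r), (L.child 0, L.child j), n1 1, ?_, (n1 0).symm,
      ⟨squareGraph_adj_root_diag L (by omega) hj hD, h1⟩,
      ⟨squareGraph_adj_root_row L hj hD, h2⟩,
      squareGraph_adj_root_diag L (by omega) hj hD,
      (squareGraph_adj_col_diag L hj (by omega) hj).2 ⟨rfl, Or.inr h0⟩⟩
    intro h
    have := L.child_inj (by omega) (by omega) (congrArg Prod.fst h)
    omega

/-- Pairs of children are mutually nonadjacent, so only one row vertex and one column vertex can be
common. This separates them from the vertices of the zigzag path. -/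
theorem not_hasThreeCommon_diag {i j : ℕ} (hi : i < D) (hj : j < D) (hD : 2 ≤ D) :
    ¬ HasThreeCommon (squareGraph L) (r, r) (L.child i, L.child j) := by
  have key : ∀ z, (squareGraph L).Adj (r, r) z → (squareGraph L).Adj (L.child i, L.child j) z →
      z = (L.child i, r) ∨ z = (r, L.child j) := by
    intro z hz hz'
    rcases squareGraph_adj_root_cases L hz hD with ⟨k, hk, rfl⟩ | ⟨k, hk, rfl⟩ | ⟨k, hk, l, hl, rfl⟩
    · rw [(squareGraph_adj_row_diag L hk hi hj).1 hz'.symm]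
      exact Or.inl rfl
    · rw [((squareGraph_adj_col_diag L hk hi hj).1 hz'.symm).1]
      exact Or.inr rfl
    · exact absurd hz' (squareGraph_not_adj_diag_diag L hi hj hk hl)
  rintro ⟨z₁, z₂, z₃, h₁₂, h₁₃, h₂₃, h₁, h₂, h₃⟩
  have k1 := key _ h₁.1 h₁.2
  have k2 := key _ h₂.1 h₂.2
  have k3 := key _ h₃.1 h₃.2
  grind

variable {σ : Equiv.Perm (V × V)}

/-- Because of the removed edge, `(child 0, child 0)` is the only neighbour of `(r, r)` sharing just
one neighbour with it, and that one is `(child 0, r)`. -/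
theorem squareGraph_apply_diag_zero
    (hσ : ∀ a b, (squareGraph L).Adj (σ a) (σ b) ↔ (squareGraph L).Adj a b)
    (hc : σ (r, r) = (r, r)) (hD : 2 ≤ D) :
    σ (L.child 0, L.child 0) = (L.child 0, L.child 0) ∧ σ (L.child 0, r) = (L.child 0, r) := by
  have hc' : ∀ z, (squareGraph L).Adj (r, r) (σ z) ↔ (squareGraph L).Adj (r, r) z :=
    fun z => by rw [← hσ (r, r) z, hc]
  have h0 : 0 < D := by omega
  have h1 : 1 < D := by omega
  have key : ∀ z, (squareGraph L).Adj (r, r) z →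
      (squareGraph L).Adj (L.child 0, L.child 0) z → z = (L.child 0, r) := by
    intro z hz hz'
    rcases squareGraph_adj_root_cases L hz hD with ⟨k, hk, rfl⟩ | ⟨k, hk, rfl⟩ | ⟨k, hk, l, hl, rfl⟩
    · rw [(squareGraph_adj_row_diag L hk h0 h0).1 hz'.symm]
    · simpa using ((squareGraph_adj_col_diag L hk h0 h0).1 hz'.symm).2
    · exact absurd hz' (squareGraph_not_adj_diag_diag L h0 h0 hk hl)
  have hdiag : σ (L.child 0, L.child 0) = (L.child 0, L.child 0) := by
    have huniq : ∀ z z', (squareGraph L).Adj (r, r) z → (squareGraph L).Adj (r, r) z' →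
        (squareGraph L).Adj (σ (L.child 0, L.child 0)) z →
        (squareGraph L).Adj (σ (L.child 0, L.child 0)) z' → z = z' := by
      intro z z' hz hz' h h'
      obtain ⟨z, rfl⟩ := σ.surjective z
      obtain ⟨z', rfl⟩ := σ.surjective z'
      rw [hσ] at h h'
      rw [key z ((hc' z).1 hz) h, key z' ((hc' z').1 hz') h']
    rcases squareGraph_adj_root_cases L ((hc' _).2 (squareGraph_adj_root_diag L h0 h0 hD)) hD with
      ⟨k, hk, e⟩ | ⟨k, hk, e⟩ | ⟨k, hk, l, hl, e⟩
    · rw [e] at huniq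
      have := huniq _ _ (squareGraph_adj_root_diag L hk h0 hD)
        (squareGraph_adj_root_diag L hk h1 hD)
        ((squareGraph_adj_row_diag L hk hk h0).2 rfl) ((squareGraph_adj_row_diag L hk hk h1).2 rfl)
      exact absurd (L.child_inj h0 h1 (congrArg Prod.snd this)) (by omega)
    · rw [e] at huniq
      have := huniq _ _ (squareGraph_adj_root_diag L h1 hk hD) (squareGraph_adj_root_row L hk hD)
        ((squareGraph_adj_col_diag L hk h1 hk).2 ⟨rfl, Or.inl (by omega)⟩)
        ((squareGraph_adj_row_col L hk hk).2 (Or.inl rfl)).symm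
      exact absurd (congrArg Prod.snd this) (L.child_ne k hk)
    · by_cases hkl : k ≠ 0 ∨ l ≠ 0
      · rw [e] at huniq
        have := huniq _ _ (squareGraph_adj_root_row L hk hD) (squareGraph_adj_root_col L hl hD)
          ((squareGraph_adj_row_diag L hk hk hl).2 rfl).symm
          ((squareGraph_adj_col_diag L hl hk hl).2 ⟨rfl, hkl⟩).symm
        exact absurd (congrArg Prod.fst this) (L.child_ne k hk)
      · obtain ⟨rfl, rfl⟩ : k = 0 ∧ l = 0 := by omega
        exact e
  refine ⟨hdiag, key _ ((hc' _).2 (squareGraph_adj_root_row L h0 hD)) ?_⟩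
  have := (hσ (L.child 0, L.child 0) (L.child 0, r)).2
    ((squareGraph_adj_row_diag L h0 h0 h0).2 rfl).symm
  rwa [hdiag] at this

/-- Walk along the zigzag path from its fixed end: the count of common neighbours keeps the image
off the pairs of children, and the preceding vertices are already taken. -/
theorem squareGraph_apply_row_col
    (hσ : ∀ a b, (squareGraph L).Adj (σ a) (σ b) ↔ (squareGraph L).Adj a b)
    (hc : σ (r, r) = (r, r)) (hD : 2 ≤ D) (i : ℕ) (hi : i < D) :
    σ (L.child i, r) = (L.child i, r) ∧ σ (r, L.child i) = (r, L.child i) := by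
  have hc' : ∀ z, (squareGraph L).Adj (r, r) (σ z) ↔ (squareGraph L).Adj (r, r) z :=
    fun z => by rw [← hσ (r, r) z, hc]
  induction i using Nat.strong_induction_on with
  | _ i ih =>
  have hrow : σ (L.child i, r) = (L.child i, r) := by
    cases i with
    | zero => exact (squareGraph_apply_diag_zero L hσ hc hD).2
    | succ i =>
      have hi' : i < D := by omega
      have h1 := (hσ (r, L.child i) (L.child (i + 1), r)).2
        ((squareGraph_adj_row_col L hi hi').2 (Or.inr rfl)).symm
      rw [(ih i (by omega) hi').2] at h1
      have h2 := (hc' _).2 (squareGraph_adj_root_row L hi hD)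
      have h3 := (hasThreeCommon_row L hi hD).map hσ hc
      rcases squareGraph_adj_root_cases L h2 hD with ⟨k, hk, e⟩ | ⟨k, hk, e⟩ | ⟨k, hk, l, hl, e⟩
      · rw [e] at h1
        rcases (squareGraph_adj_row_col L hk hi').1 h1.symm with rfl | rfl
        · exact σ.injective (by rw [e, (ih k (by omega) hk).1])
        · exact e
      · rw [e] at h1
        exact absurd h1 (squareGraph_not_adj_col_col L hi' hk)
      · rw [e] at h3
        exact absurd h3 (not_hasThreeCommon_diag L hk hl hD)
  refine ⟨hrow, ?_⟩
  have h1 := (hσ (L.child i, r) (r, L.child i)).2 ((squareGraph_adj_row_col L hi hi).2 (Or.inl rfl))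
  rw [hrow] at h1
  have h2 := (hc' _).2 (squareGraph_adj_root_col L hi hD)
  have h3 := (hasThreeCommon_col L hi hD).map hσ hc
  rcases squareGraph_adj_root_cases L h2 hD with ⟨k, hk, e⟩ | ⟨k, hk, e⟩ | ⟨k, hk, l, hl, e⟩
  · rw [e] at h1
    exact absurd h1 (squareGraph_not_adj_row_row L hi hk)
  · rw [e] at h1
    rcases (squareGraph_adj_row_col L hi hk).1 h1 with rfl | rfl
    · exact e
    · exact σ.injective (by rw [e, (ih k (by omega) hk).2])
  · rw [e] at h3
    exact absurd h3 (not_hasThreeCommon_diag L hk hl hD)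

theorem squareGraph_apply_near_near
    (hσ : ∀ a b, (squareGraph L).Adj (σ a) (σ b) ↔ (squareGraph L).Adj a b)
    (hc : σ (r, r) = (r, r)) (hD : 2 ≤ D) {x y : V} (hx : P.Near x) (hy : P.Near y) :
    σ (x, y) = (x, y) := by
  have hc' : ∀ z, (squareGraph L).Adj (r, r) (σ z) ↔ (squareGraph L).Adj (r, r) z :=
    fun z => by rw [← hσ (r, r) z, hc]
  by_cases h : (x, y) = (r, r)
  · rw [h, hc]
  rcases squareGraph_adj_root_cases L ((squareGraph_adj_root L hD).2 ⟨h, hx, hy⟩) hD with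
    ⟨i, hi, e⟩ | ⟨i, hi, e⟩ | ⟨i, hi, j, hj, e⟩
  · rw [e, (squareGraph_apply_row_col L hσ hc hD i hi).1]
  · rw [e, (squareGraph_apply_row_col L hσ hc hD i hi).2]
  · rw [e]
    by_cases hij : i ≠ 0 ∨ j ≠ 0
    · have h1 := (hσ (L.child i, r) (L.child i, L.child j)).2
        ((squareGraph_adj_row_diag L hi hi hj).2 rfl)
      have h2 := (hσ (r, L.child j) (L.child i, L.child j)).2
        ((squareGraph_adj_col_diag L hj hi hj).2 ⟨rfl, hij⟩)
      rw [(squareGraph_apply_row_col L hσ hc hD i hi).1] at h1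
      rw [(squareGraph_apply_row_col L hσ hc hD j hj).2] at h2
      rcases squareGraph_adj_root_cases L ((hc' _).2 (squareGraph_adj_root_diag L hi hj hD)) hD with
        ⟨k, hk, e⟩ | ⟨k, hk, e⟩ | ⟨k, hk, l, hl, e⟩
      · rw [e] at h1
        exact absurd h1 (squareGraph_not_adj_row_row L hi hk)
      · rw [e] at h2
        exact absurd h2 (squareGraph_not_adj_col_col L hj hk)
      · rw [e] at h1 h2 ⊢
        rw [← (squareGraph_adj_row_diag L hi hk hl).1 h1,
          ((squareGraph_adj_col_diag L hj hk hl).1 h2).1]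
    · obtain ⟨rfl, rfl⟩ : i = 0 ∧ j = 0 := by omega
      exact (squareGraph_apply_diag_zero L hσ hc hD).1

/-! ### Propagation to all vertices, and rigidity -/

theorem squareGraph_apply_near
    (hσ : ∀ a b, (squareGraph L).Adj (σ a) (σ b) ↔ (squareGraph L).Adj a b)
    (hc : σ (r, r) = (r, r)) (hD : 2 ≤ D) (x : V) {y : V} (hy : P.Near y) :
    σ (x, y) = (x, y) := by
  induction hn : P.depth x using Nat.strong_induction_on generalizing x y with
  | _ n ih =>
  by_cases hx : P.Near x
  · exact squareGraph_apply_near_near L hσ hc hD hx hy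
  obtain ⟨hx, hpx⟩ := not_or.1 hx
  have hd := P.depth_parent x hx
  have fixed : ∀ w : V × V, P.depth w.1 ≤ P.depth (P.parent x) ∧ P.Near w.2 → σ w = w :=
    fun w hw => ih _ (by omega) w.1 hw.2 rfl
  have hl := L.label_lt x hx
  have hlab : P.Near (L.child (L.label x)) := Or.inr (L.parent_child _ hl)
  -- The vertex `(x, r)` must come first, since it serves as a fixed neighbour for `(x, y)` below.
  have hroot : σ (x, r) = (x, r) := by
    refine apply_eq_of_adj_of_adj hσ (fixed (P.parent x, r) ⟨le_rfl, Or.inl rfl⟩)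
      (fixed (P.parent x, L.child (L.label x)) ⟨le_rfl, hlab⟩) ?_ ?_
      fun w h1 h2 => (squareGraph_common_column L hx hpx h1 h2).imp_right (fixed w)
    · exact Or.inr (Or.inl ⟨hx, rfl, fun h => L.child_ne 0 (by omega) h.2.symm⟩)
    · exact Or.inr (Or.inr (Or.inr (Or.inr (Or.inl ⟨hx, rfl, rfl⟩))))
  by_cases hyr : y = r
  · rw [hyr, hroot]
  have hpy := hy.resolve_left hyr
  refine apply_eq_of_adj_of_adj hσ hroot (fixed (P.parent x, y) ⟨le_rfl, hy⟩) ?_ ?_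
    fun w h1 h2 => (squareGraph_common_near L hx hpx hyr hpy h1 h2).imp_right (fixed w)
  · exact Or.inr (Or.inr (Or.inl ⟨hyr, by rw [hpy]⟩))
  · refine Or.inr (Or.inl ⟨hx, rfl, fun h => hpx ?_⟩)
    have h1 : x = L.child 0 := h.1
    rw [h1, L.parent_child 0 (by omega)]

theorem squareGraph_apply
    (hσ : ∀ a b, (squareGraph L).Adj (σ a) (σ b) ↔ (squareGraph L).Adj a b)
    (hc : σ (r, r) = (r, r)) (hD : 2 ≤ D) (x y : V) : σ (x, y) = (x, y) := by
  induction hn : P.depth y using Nat.strong_induction_on generalizing x y with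
  | _ n ih =>
  by_cases hy : P.Near y
  · exact squareGraph_apply_near L hσ hc hD x hy
  obtain ⟨hy, hpy⟩ := not_or.1 hy
  have hd := P.depth_parent y hy
  have fixed : ∀ w : V × V, P.depth w.2 ≤ P.depth (P.parent y) → σ w = w :=
    fun w hw => ih _ (by omega) w.1 w.2 rfl
  have hl := L.label_lt y hy
  -- Within the level of `y`, proceed down the tree in the first coordinate; all lower depths of the
  -- second coordinate are already fixed.
  induction x using P.induction with
  | root =>
    refine apply_eq_of_adj_of_adj hσ (fixed (r, P.parent y) le_rfl)
      (fixed (L.child (L.label y), P.parent y) le_rfl) ?_ ?_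
      fun w h1 h2 => (squareGraph_common_row L hy hpy h1 h2).imp_right (fixed w)
    · exact Or.inr (Or.inr (Or.inl ⟨hy, rfl⟩))
    · exact Or.inr (Or.inr (Or.inr (Or.inr (Or.inr (Or.inl ⟨rfl, hy, rfl⟩)))))
  | step x hx ihx =>
    refine apply_eq_of_adj_of_adj hσ ihx (fixed (x, P.parent y) le_rfl) ?_ ?_
      fun w h1 h2 => (squareGraph_common_far L hx hy hpy h1 h2).imp_right (fixed w)
    · refine Or.inr (Or.inl ⟨hx, rfl, fun h => hpy ?_⟩)
      have h2 : y = L.child 0 := h.2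
      rw [h2, L.parent_child 0 (by omega)]
    · exact Or.inr (Or.inr (Or.inl ⟨hy, rfl⟩))

theorem squareGraph_rigid [Fintype V] [DecidableRel G.Adj] (hG : ∀ x, G.degree x ≤ D)
    (hD : 2 ≤ D) : (squareGraph L).Rigid := by
  classical
  intro σ hσ
  have hc : σ (r, r) = (r, r) := apply_eq_of_degree_lt hσ fun v hv =>
    (squareGraph_degree_lt L hG hD hv).trans_le (squareGraph_degree_root L hD)
  exact fun v => squareGraph_apply L hσ hc hD v.1 v.2

theorem squareGraph_connected (hD : 2 ≤ D) : (squareGraph L).Connected := by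
  have h1 : ∀ x, (squareGraph L).Reachable (x, r) (r, r) := by
    intro x
    induction x using P.induction with
    | root => exact Reachable.refl _
    | step x hx ih =>
      exact (Adj.reachable (Or.inl (Or.inl
        ⟨hx, rfl, fun h => L.child_ne 0 (by omega) h.2.symm⟩))).trans ih
  have h2 : ∀ x y, (squareGraph L).Reachable (x, y) (r, r) := by
    intro x y
    induction y using P.induction with
    | root => exact h1 x
    | step y hy ih => exact (Adj.reachable (Or.inl (Or.inr (Or.inl ⟨hy, rfl⟩)))).trans ih
  have : Nonempty (V × V) := ⟨(r, r)⟩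
  exact ⟨fun a b => (h2 a.1 a.2).trans (h2 b.1 b.2).symm⟩

theorem squareGraph_adj_le {v w : V × V} (h : (squareGraph L).Adj v w) :
    (v.1 = w.1 ∨ G.Adj v.1 w.1) ∧ (v.2 = w.2 ∨ G.Adj v.2 w.2) := by
  have key : ∀ v w, SquareArc L v w →
      (v.1 = w.1 ∨ G.Adj v.1 w.1) ∧ (v.2 = w.2 ∨ G.Adj v.2 w.2) := by
    have hchild : ∀ i < D, G.Adj r (L.child i) := fun i hi => by
      have := P.adj_parent _ (L.child_ne i hi)
      rw [L.parent_child i hi] at this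
      exact this.symm
    have hup : ∀ x, x ≠ r → P.parent x = r → G.Adj x r := fun x hx hpx => by
      have := P.adj_parent x hx
      rwa [hpx] at this
    rintro ⟨x, y⟩ ⟨a, b⟩ h
    simp only [SquareArc, Prod.mk.injEq] at h
    rcases h with ⟨hx, ⟨rfl, rfl⟩, -⟩ | ⟨hy, rfl, rfl⟩ | ⟨hx, hpx, hy, hpy, rfl, rfl⟩ |
      ⟨hx, rfl, rfl, rfl⟩ | ⟨rfl, hy, rfl, rfl⟩ | ⟨hx, hpx, rfl, -, rfl, rfl⟩
    · exact ⟨Or.inr (P.adj_parent x hx), Or.inl rfl⟩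
    · exact ⟨Or.inl rfl, Or.inr (P.adj_parent y hy)⟩
    · exact ⟨Or.inr (hup x hx hpx), Or.inr (hup y hy hpy)⟩
    · exact ⟨Or.inr (P.adj_parent x hx), Or.inr (hchild _ (L.label_lt x hx))⟩
    · exact ⟨Or.inr (hchild _ (L.label_lt y hy)), Or.inr (P.adj_parent y hy)⟩
    · have := L.label_lt x hx
      exact ⟨Or.inr (hup x hx hpx), Or.inr (hchild _ (by omega))⟩
  rcases h with h | h
  · exact key v w h
  · have := key w v h
    exact ⟨this.1.imp Eq.symm Adj.symm, this.2.imp Eq.symm Adj.symm⟩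

theorem joinCopies_adj_le {Y : Type*} (P : G.ParentMap r) {K : SimpleGraph Y} {f : V → Y}
    {v w : V × Y} (h : (P.joinCopies K f).Adj v w) :
    (v.1 = w.1 ∨ G.Adj v.1 w.1) ∧ (v.2 = w.2 ∨ K.Adj v.2 w.2) := by
  rcases h with h | ⟨h1, h2, h3⟩ | ⟨h1, h2, h3⟩
  · exact ⟨Or.inl h.1, Or.inr h.2⟩
  · rw [h2]
    exact ⟨Or.inr (P.adj_parent _ h1), Or.inl h3⟩
  · rw [h2]
    exact ⟨Or.inr (P.adj_parent _ h1).symm, Or.inl h3.symm⟩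

/-- A vertex whose parent is not the root would give that parent two neighbours. Otherwise all
vertices are children of the root, and there are at least two. -/
theorem two_le_degree [Fintype V] [DecidableRel G.Adj] (P : G.ParentMap r)
    (hr : ∀ x, G.degree x ≤ G.degree r) (hV : 3 ≤ Fintype.card V) : 2 ≤ G.degree r := by
  classical
  by_contra! hD
  have hpar : ∀ x, x ≠ r → P.parent x = r := by
    intro x hx
    by_contra hpx
    have h1 := P.depth_parent x hx
    have h2 := P.depth_parent _ hpx
    have hne : x ≠ P.parent (P.parent x) := fun h => by
      have := congrArg P.depth h
      omega
    have hsub : ({x, P.parent (P.parent x)} : Finset V) ⊆ G.neighborFinset (P.parent x) := by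
      simp only [Finset.insert_subset_iff, Finset.singleton_subset_iff, mem_neighborFinset]
      exact ⟨(P.adj_parent x hx).symm, P.adj_parent _ hpx⟩
    have h3 := Finset.card_le_card hsub
    rw [Finset.card_pair hne, card_neighborFinset_eq_degree] at h3
    have := hr (P.parent x)
    omega
  have hsub : Finset.univ.erase r ⊆ G.neighborFinset r := fun x hx => by
    have hx := Finset.ne_of_mem_erase hx
    have := P.adj_parent x hx
    rw [hpar x hx] at this
    simpa using this.symm
  have := Finset.card_le_card hsub
  rw [Finset.card_erase_of_mem (Finset.mem_univ r), Finset.card_univ,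
    card_neighborFinset_eq_degree] at this
  omega

end ParentMap

/-! ### Induction on the exponent and the main theorem -/

/-- Connectedness is carried along because joining copies requires it of `K`. The induction starts
at the square, since a graph such as the path on three vertices has no rigid spanning subgraph
itself. -/
theorem exists_rigid_le_strongPower {V : Type*} [Fintype V] (G : SimpleGraph V)
    (hG : G.Connected) (hV : 3 ≤ Fintype.card V) (k : ℕ) :
    ∃ H : SimpleGraph (Fin (k + 2) → V), H ≤ G.strongPower (k + 2) ∧ H.Connected ∧ H.Rigid := by
  classical
  have := hG.nonempty
  obtain ⟨r, hr⟩ := G.exists_maximal_degree_vertex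
  have hr : ∀ x, G.degree x ≤ G.degree r := fun x => hr ▸ G.degree_le_maxDegree x
  obtain ⟨P⟩ := hG.nonempty_parentMap r
  induction k with
  | zero =>
    have hD := P.two_le_degree hr hV
    obtain ⟨L⟩ := P.nonempty_siblingLabels hr
    refine ⟨(ParentMap.squareGraph L).comap (finTwoArrowEquiv V), fun x y h => ?_,
      (ParentMap.squareGraph_connected L hD).comap_equiv _,
      (ParentMap.squareGraph_rigid L hr hD).comap _⟩
    refine ⟨h.ne, ?_⟩
    have := ParentMap.squareGraph_adj_le L h
    intro i
    fin_cases i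
    · exact this.1
    · exact this.2
  | succ k ih =>
    obtain ⟨K, hK, hKc, hKr⟩ := ih
    -- Constant tuples supply enough distinct rows, one for each vertex of `G`.
    let f : V → Fin (k + 2) → V := fun x _ => x
    have hf : f.Injective := fun x y h => congrFun h 0
    let e : (Fin (k + 3) → V) ≃ V × (Fin (k + 2) → V) := (Fin.consEquiv fun _ => V).symm
    refine ⟨(P.joinCopies K f).comap e, fun x y h => ?_,
      (P.joinCopies_connected hKc f).comap_equiv _, (P.joinCopies_rigid hKc hKr hf hV).comap _⟩
    refine ⟨h.ne, ?_⟩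
    have := P.joinCopies_adj_le h
    intro i
    refine Fin.cases this.1 (fun i => ?_) i
    rcases this.2 with h' | h'
    · exact Or.inl (congrFun h' i)
    · exact (hK h').2 i

end SimpleGraph

theorem mainTheorem8 {V : Type*} [Fintype V] [Nontrivial V] (G : SimpleGraph V)
    [DecidableRel G.Adj] (hG : G.Connected) (Δ : ℕ) (hΔ : 2 ≤ Δ) (hdeg : G.maxDegree ≤ Δ)
    (hcard : 7 ≤ Fintype.card V ^ Δ) :
    (G.strongPower Δ).distinguishingIndex = 2 := by
  classical
  refine le_antisymm ?_ (G.two_le_distinguishingIndex_strongPower hΔ)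
  obtain ⟨k, rfl⟩ : ∃ k, Δ = k + 2 := ⟨Δ - 2, by omega⟩
  by_cases hV : 3 ≤ Fintype.card V
  · obtain ⟨H, hle, -, hH⟩ := G.exists_rigid_le_strongPower hG hV k
    exact SimpleGraph.distinguishingIndex_le_two hle hH
  · have h2 : Fintype.card V = 2 := by
      have := Fintype.one_lt_card (α := V)
      omega
    obtain ⟨H, hH⟩ := SimpleGraph.exists_rigid (V := Fin (k + 2) → V)
      (by rw [Fintype.card_fun, Fintype.card_fin]; omega)
    refine SimpleGraph.distinguishingIndex_le_two (H := H) (fun x y h => ⟨h.ne, fun i => ?_⟩) hH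
    by_cases hxy : x i = y i
    · exact Or.inl hxy
    right
    obtain ⟨z, hz⟩ := (G.degree_pos_iff_exists_adj _).1
      (hG.preconnected.degree_pos_of_nontrivial (x i))
    -- With only two vertices, any neighbour of `x i` is the other vertex, so the power is complete.
    have hzy : z = y i := by
      by_contra hzy
      have := Fintype.two_lt_card_iff.2 ⟨x i, y i, z, hxy, hz.ne, Ne.symm hzy⟩
      omega
    exact hzy ▸ hz
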